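/- Let $a,b\ge 0$ be integers and consider the finite 2D square lattice (with open boundary) whose vertices are the points $(i,j)$, $0\le i\le a$, $0\le j\le b$, and whose plaquettes are its $ab$ unit squares. On each vertex $q$ there is a qudit with Hilbert space $\mathcal H^q=\mathbb C^{d_q}$ of arbitrary finite dimension $d_q$ (depending on $q$); let $\mathcal H=\bigotimes_q\mathcal H^q$. For each plaquette $p$ let $h_p$ be an operator on $\mathcal H$ of the form $h_p=h_p^{q_1}\otimes h_p^{q_2}\otimes h_p^{q_3}\otimes h_p^{q_4}$, where $q_1,\dots,q_4$ are the four vertices of $p$, each $h_p^{q_i}$ is a Hermitian operator on $\mathcal H^{q_i}$, and $h_p$ acts as the identity on all other qudits. Suppose that the terms $h_p$ commute pairwise, and put $H=\sum_p h_p$. **Theorem.** $H$ is equivalent to a direct sum of qubit stabilizer Hamiltonians. That is, there is a finite family of simple subspaces $\mathcal H_*=\bigotimes_q\mathcal H^q_*$, with $\mathcal H^q_*\subseteq\mathcal H^q$ a linear subspace for each $q$, such that 1. the subspaces $\mathcal H_*$ are pairwise orthogonal and $\mathcal H=\bigoplus_*\mathcal H_*$; 2. $H$ and every term $h_p$ keep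 every $\mathcal H_*$ invariant; 3. for every $*$ there are integers $m^q\ge 0$ and unitary identifications $\mathcal H^q_*\cong(\mathbb C^2)^{\otimes m^q}$, one for each qudit $q$ (with $m^q=0$ meaning $\dim\mathcal H^q_*=1$), such that, with respect to the induced identification $\mathcal H_*\cong(\mathbb C^2)^{\otimes\sum_q m^q}$, every term $h_p$ acts on $\mathcal H_*$ as $c\,P$ for some real number $c$ (possibly $0$) and some tensor product $P$ of the Pauli matrices $I,X,Y,Z$; here $c$ and $P$ may depend on $p$ and on $*$. -/

import Mathlib

open scoped BigOperators

/-- The Hilbert space `⨂_q ℂ^{d q}` of a finite family of qudits, the qudit `q` having dimension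
`d q`, written in the product basis `|x⟩ = ⨂_q |x q⟩`. -/
abbrev QuditSpace {Q : Type} (d : Q → ℕ) : Type :=
  EuclideanSpace ℂ ((q : Q) → Fin (d q))

/-- Operators on `⨂_q ℂ^{d q}`, as matrices in the product basis. -/
abbrev QuditOp {Q : Type} (d : Q → ℕ) : Type :=
  Matrix ((q : Q) → Fin (d q)) ((q : Q) → Fin (d q)) ℂ

/-- The action of a matrix on vectors of the Euclidean (Hilbert) space. -/
def applyOp {X : Type} [Fintype X] (A : Matrix X X ℂ) (ψ : EuclideanSpace ℂ X) :
    EuclideanSpace ℂ X :=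
  WithLp.toLp 2 (A.mulVec ψ.ofLp)

/-- The product vector `⨂_q v q`. -/
def tensorVec {Q : Type} [Fintype Q] {d : Q → ℕ}
    (v : (q : Q) → EuclideanSpace ℂ (Fin (d q))) : QuditSpace d :=
  WithLp.toLp 2 (fun x => ∏ q, v q (x q))

/-- The tensor product operator `⨂_q A q`. -/
def tensorOp {Q : Type} [Fintype Q] {d : Q → ℕ}
    (A : (q : Q) → Matrix (Fin (d q)) (Fin (d q)) ℂ) : QuditOp d :=
  Matrix.of (fun x y => ∏ q, A q (x q) (y q))

/-- `h` is a tensor product of single-qudit Hermitian operators, one for each qudit of `S`, and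
it is the identity on the qudits outside `S`. -/
def IsFactorizedOn {Q : Type} [Fintype Q] {d : Q → ℕ} (S : Set Q) (h : QuditOp d) : Prop :=
  ∃ A : (q : Q) → Matrix (Fin (d q)) (Fin (d q)) ℂ,
    (∀ q ∈ S, (A q).IsHermitian) ∧ (∀ q ∉ S, A q = 1) ∧ h = tensorOp A

/-- The subspace `⨂_q V q` of `⨂_q ℂ^{d q}`: the span of the product vectors `⨂_q v q` with
`v q ∈ V q`. The simple subspaces are exactly the subspaces of this form. -/
def tensorSubspace {Q : Type} [Fintype Q] {d : Q → ℕ}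
    (V : (q : Q) → Submodule ℂ (EuclideanSpace ℂ (Fin (d q)))) : Submodule ℂ (QuditSpace d) :=
  Submodule.span ℂ {ψ | ∃ v : (q : Q) → EuclideanSpace ℂ (Fin (d q)),
    (∀ q, v q ∈ V q) ∧ ψ = tensorVec v}

/-- The operator `A` keeps the subspace `W` invariant. -/
def KeepsInvariant {X : Type} [Fintype X] (A : Matrix X X ℂ)
    (W : Submodule ℂ (EuclideanSpace ℂ X)) : Prop :=
  ∀ ψ ∈ W, applyOp A ψ ∈ W

/-- Labels of the four single-qubit Pauli matrices. -/
inductive PauliLabel : Type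
  | I
  | X
  | Y
  | Z

/-- The Pauli matrices. -/
def PauliLabel.toMatrix : PauliLabel → Matrix (Fin 2) (Fin 2) ℂ
  | PauliLabel.I => 1
  | PauliLabel.X => !![0, 1; 1, 0]
  | PauliLabel.Y => !![0, -Complex.I; Complex.I, 0]
  | PauliLabel.Z => !![1, 0; 0, -1]

/-- The space `(ℂ²)^{⊗ m}` of `m` qubits; it is one-dimensional for `m = 0`. -/
abbrev QubitSpace (m : ℕ) : Type := QuditSpace (fun _ : Fin m => 2)

/-- The Pauli operator `σ_{s 0} ⊗ ⋯ ⊗ σ_{s (m - 1)}` on `m` qubits. -/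
def pauliString {m : ℕ} (s : Fin m → PauliLabel) : QuditOp (fun _ : Fin m => 2) :=
  tensorOp (fun j => (s j).toMatrix)

/-- The family `h` of operators is equivalent to a qubit stabilizer Hamiltonian on the simple
subspace `⨂_q V q`: every factor `V q` is unitarily identified with a space of `m q` qubits, and
with respect to the resulting identification of `⨂_q V q` with a space of `∑_q m q` qubits every
`h i` acts on `⨂_q V q` as a real multiple of a tensor product of Pauli matrices. Equality of
the two linear maps is stated on product vectors, which span `⨂_q V q`. -/
def IsEquivQubitStabilizerOn {Q : Type} [Fintype Q] [DecidableEq Q] {d : Q → ℕ} {ι : Type}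
    (h : ι → QuditOp d) (V : (q : Q) → Submodule ℂ (EuclideanSpace ℂ (Fin (d q)))) : Prop :=
  ∃ (m : Q → ℕ) (U : (q : Q) → QubitSpace (m q) ≃ₗᵢ[ℂ] V q),
    ∀ i, ∃ (c : ℝ) (s : (q : Q) → Fin (m q) → PauliLabel),
      ∀ ψ : (q : Q) → QubitSpace (m q),
        applyOp (h i) (tensorVec (fun q => (U q (ψ q) : EuclideanSpace ℂ (Fin (d q))))) =
          (c : ℂ) • tensorVec (fun q =>
            (U q (applyOp (pauliString (s q)) (ψ q)) : EuclideanSpace ℂ (Fin (d q))))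

/-- The Hamiltonian `H = ∑ i, h i` is equivalent to a direct sum of qubit stabilizer
Hamiltonians: the whole space is the direct sum of pairwise orthogonal simple subspaces
`⨂_q V k q`, each of them invariant under `H` and under all terms `h i`, and on each of them the
Hamiltonian is equivalent to a qubit stabilizer Hamiltonian. -/
def IsEquivDirectSumQubitStabilizer {Q : Type} [Fintype Q] [DecidableEq Q] {d : Q → ℕ}
    {ι : Type} [Fintype ι] (h : ι → QuditOp d) : Prop :=
  ∃ (N : ℕ) (V : Fin N → (q : Q) → Submodule ℂ (EuclideanSpace ℂ (Fin (d q)))),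
    (Pairwise fun k l => tensorSubspace (V k) ⟂ tensorSubspace (V l)) ∧
    DirectSum.IsInternal (fun k => tensorSubspace (V k)) ∧
    ∀ k, KeepsInvariant (∑ i, h i) (tensorSubspace (V k)) ∧
      (∀ i, KeepsInvariant (h i) (tensorSubspace (V k))) ∧
      IsEquivQubitStabilizerOn h (V k)

/-- Vertices of the 2D square lattice with `a × b` plaquettes. -/
abbrev LatticeVertex (a b : ℕ) : Type := Fin (a + 1) × Fin (b + 1)

/-- Plaquettes (unit squares) of the 2D square lattice with `a × b` plaquettes. -/
abbrev LatticePlaquette (a b : ℕ) : Type := Fin a × Fin b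

/-- The four vertices of the plaquette `(i, j)`: `(i, j)`, `(i + 1, j)`, `(i, j + 1)` and
`(i + 1, j + 1)`. -/
def plaquetteVertices {a b : ℕ} (p : LatticePlaquette a b) : Set (LatticeVertex a b) :=
  {(p.1.castSucc, p.2.castSucc), (p.1.succ, p.2.castSucc),
    (p.1.castSucc, p.2.succ), (p.1.succ, p.2.succ)}

/-!
Two commuting non-zero products of Hermitian operators either annihilate each other in some factor,
or commute or anticommute in every factor
(`exists_mul_eq_zero_or_commute_or_anticommute`). Only the first case is far from the stabilizer
setting, and the geometry of the lattice makes it disappear once the space has been decomposed far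
enough.

The space is cut into simple subspaces (`IsBrick`). Terms vanishing on a simple subspace are
replaced there by `0` times the identity, and a simple subspace is split further whenever the operators
acting on one of its factors have a common proper invariant subspace
(`IsBrick.hasStabilizerDecomposition`). On the final pieces all factors of all terms are non-zero
and at every qudit they act irreducibly.

Suppose that on such a piece the factors `A` and `B` of two terms at a vertex satisfy `A * B = 0`.
If `A` commuted or anticommuted with all operators at this vertex, then `A * A` would be a scalar by
Schur's lemma, non-zero because `A` is Hermitian and non-zero, which contradicts `A * B = 0` with
`B ≠ 0`. So `A` neither commutes nor anticommutes with the factor of some third term, and then the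
terms of `A` and of this third one must annihilate each other at another common vertex, the other
end of the edge separating the two plaquettes. Repeating the argument leads along a
staircase to the south-east, out of the lattice (`noPropagation_plaquetteVertices`). Hence there is
no such pair, and all factors commute up to sign (`IsBrick.commuteUpToSign`).

Finally, an irreducible family of Hermitian operators that commute pairwise up to sign consists of
multiples of Pauli strings (`exists_qubitSpace_equiv`): the squares are scalars, and an
anticommuting pair of involutions splits off a qubit.
-/

/-! ### Tensor products of vectors, operators and subspaces -/

section TensorBasics

variable {Q : Type} [Fintype Q] {d : Q → ℕ}

theorem toEuclideanLin_eq_applyOp {X : Type} [Fintype X] [DecidableEq X] (A : Matrix X X ℂ)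
    (ψ : EuclideanSpace ℂ X) : Matrix.toEuclideanLin A ψ = applyOp A ψ := rfl

theorem applyOp_tensorOp_tensorVec [DecidableEq Q]
    (A : (q : Q) → Matrix (Fin (d q)) (Fin (d q)) ℂ)
    (v : (q : Q) → EuclideanSpace ℂ (Fin (d q))) :
    applyOp (tensorOp A) (tensorVec v) = tensorVec (fun q => applyOp (A q) (v q)) := by
  ext x
  simp only [applyOp, tensorOp, tensorVec, Matrix.mulVec, dotProduct, Matrix.of_apply]
  rw [Finset.prod_univ_sum, Fintype.piFinset_univ]
  simp only [Finset.prod_mul_distrib]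

theorem inner_tensorVec [DecidableEq Q] (v w : (q : Q) → EuclideanSpace ℂ (Fin (d q))) :
    inner ℂ (tensorVec v) (tensorVec w) = ∏ q, inner ℂ (v q) (w q) := by
  simp only [PiLp.inner_apply, tensorVec]
  rw [Finset.prod_univ_sum, Fintype.piFinset_univ]
  simp [Finset.prod_mul_distrib]

theorem tensorOp_mul [DecidableEq Q] (A B : (q : Q) → Matrix (Fin (d q)) (Fin (d q)) ℂ) :
    tensorOp A * tensorOp B = tensorOp (fun q => A q * B q) := by
  ext x y
  simp only [tensorOp, Matrix.mul_apply, Matrix.of_apply]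
  rw [Finset.prod_univ_sum, Fintype.piFinset_univ]
  simp only [Finset.prod_mul_distrib]

theorem tensorVec_update_add [DecidableEq Q] (v : (q : Q) → EuclideanSpace ℂ (Fin (d q)))
    (q : Q) (x y : EuclideanSpace ℂ (Fin (d q))) :
    tensorVec (Function.update v q (x + y)) =
      tensorVec (Function.update v q x) + tensorVec (Function.update v q y) := by
  ext z
  simp only [tensorVec, PiLp.add_apply]
  rw [← Finset.mul_prod_erase _ _ (Finset.mem_univ q),
    ← Finset.mul_prod_erase _ _ (Finset.mem_univ q),
    ← Finset.mul_prod_erase _ _ (Finset.mem_univ q)]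
  have key : ∀ t, ∏ r ∈ Finset.univ.erase q, (Function.update v q t r) (z r) =
      ∏ r ∈ Finset.univ.erase q, v r (z r) := fun t =>
    Finset.prod_congr rfl fun r hr => by
      rw [Function.update_of_ne (Finset.ne_of_mem_erase hr)]
  simp [key, add_mul]

theorem tensorVec_eq_zero {v : (q : Q) → EuclideanSpace ℂ (Fin (d q))} {q : Q} (h : v q = 0) :
    tensorVec v = 0 := by
  ext z
  exact Finset.prod_eq_zero (Finset.mem_univ q) (by simp [h])

theorem tensorVec_smul (c : Q → ℂ) (v : (q : Q) → EuclideanSpace ℂ (Fin (d q))) :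
    tensorVec (fun q => c q • v q) = (∏ q, c q) • tensorVec v := by
  ext z
  simp [tensorVec, Finset.prod_mul_distrib]

theorem tensorVec_mem_tensorSubspace
    {V : (q : Q) → Submodule ℂ (EuclideanSpace ℂ (Fin (d q)))}
    {v : (q : Q) → EuclideanSpace ℂ (Fin (d q))} (hv : ∀ q, v q ∈ V q) :
    tensorVec v ∈ tensorSubspace V :=
  Submodule.subset_span ⟨v, hv, rfl⟩

theorem tensorSubspace_le {V : (q : Q) → Submodule ℂ (EuclideanSpace ℂ (Fin (d q)))}
    {M : Submodule ℂ (QuditSpace d)} (h : ∀ v, (∀ q, v q ∈ V q) → tensorVec v ∈ M) :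
    tensorSubspace V ≤ M := by
  refine Submodule.span_le.2 ?_
  rintro _ ⟨v, hv, rfl⟩
  exact h v hv

theorem tensorSubspace_mono {V W : (q : Q) → Submodule ℂ (EuclideanSpace ℂ (Fin (d q)))}
    (h : ∀ q, V q ≤ W q) : tensorSubspace V ≤ tensorSubspace W :=
  tensorSubspace_le fun _ hv => tensorVec_mem_tensorSubspace fun q => h q (hv q)

theorem tensorSubspace_eq_bot {V : (q : Q) → Submodule ℂ (EuclideanSpace ℂ (Fin (d q)))} {q : Q}
    (h : V q = ⊥) : tensorSubspace V = ⊥ := by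
  refine le_bot_iff.1 (tensorSubspace_le fun v hv => ?_)
  have : v q = 0 := by simpa [h] using hv q
  simp [tensorVec_eq_zero this]

theorem tensorSubspace_top [DecidableEq Q] :
    tensorSubspace (fun q => (⊤ : Submodule ℂ (EuclideanSpace ℂ (Fin (d q))))) = ⊤ := by
  refine top_le_iff.1 ?_
  rw [← (EuclideanSpace.basisFun ((q : Q) → Fin (d q)) ℂ).toBasis.span_eq, Submodule.span_le]
  rintro _ ⟨x, rfl⟩
  refine Submodule.subset_span ⟨fun q => EuclideanSpace.single (x q) 1, fun _ => trivial, ?_⟩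
  ext y
  simp only [OrthonormalBasis.coe_toBasis, EuclideanSpace.basisFun_apply, tensorVec,
    PiLp.single_apply]
  by_cases hxy : y = x
  · simp [hxy]
  · obtain ⟨q, hq⟩ := Function.ne_iff.1 hxy
    rw [if_neg hxy, Finset.prod_eq_zero (Finset.mem_univ q) (if_neg hq)]

theorem tensorSubspace_isOrtho [DecidableEq Q]
    {V W : (q : Q) → Submodule ℂ (EuclideanSpace ℂ (Fin (d q)))} {q : Q} (h : V q ⟂ W q) :
    tensorSubspace V ⟂ tensorSubspace W := by
  refine Submodule.isOrtho_span.2 ?_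
  rintro _ ⟨v, hv, rfl⟩ _ ⟨w, hw, rfl⟩
  rw [inner_tensorVec]
  exact Finset.prod_eq_zero (Finset.mem_univ q) (h.inner_eq (hv q) (hw q))

/-- A tensor product of subspaces is additive in each factor. -/
theorem tensorSubspace_update_sup [DecidableEq Q]
    (V : (q : Q) → Submodule ℂ (EuclideanSpace ℂ (Fin (d q)))) (q : Q)
    {W₁ W₂ : Submodule ℂ (EuclideanSpace ℂ (Fin (d q)))} (h : W₁ ⊔ W₂ = V q) :
    tensorSubspace (Function.update V q W₁) ⊔ tensorSubspace (Function.update V q W₂) =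
      tensorSubspace V := by
  have mono : ∀ W ≤ V q, tensorSubspace (Function.update V q W) ≤ tensorSubspace V :=
    fun W hW => tensorSubspace_mono fun r => by
      by_cases hr : r = q
      · subst hr; simpa using hW
      · simp [Function.update_of_ne hr]
  refine le_antisymm (sup_le (mono _ (h ▸ le_sup_left)) (mono _ (h ▸ le_sup_right)))
    (tensorSubspace_le fun v hv => ?_)
  obtain ⟨x, hx, y, hy, hxy⟩ := Submodule.mem_sup.1 (h.symm ▸ hv q)
  have mem : ∀ (W : Submodule ℂ (EuclideanSpace ℂ (Fin (d q)))), ∀ w ∈ W,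
      tensorVec (Function.update v q w) ∈ tensorSubspace (Function.update V q W) :=
    fun W w hw => tensorVec_mem_tensorSubspace fun r => by
      by_cases hr : r = q
      · subst hr; simpa using hw
      · simpa [Function.update_of_ne hr] using hv r
  rw [← Function.update_eq_self q v, ← hxy, tensorVec_update_add]
  exact Submodule.add_mem_sup (mem _ _ hx) (mem _ _ hy)

end TensorBasics

/-! ### Commuting products of Hermitian matrices -/

section ProductOperators

open Matrix

open scoped ComplexOrder in
/-- If a product of two Hermitian matrices is proportional to the product in the other order and
does not vanish, the matrices commute or anticommute. With `K = A * B`, the factor `l` in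
`K = l • Kᴴ` satisfies `l * conj l = 1`, and it is real because `K * K` and `Kᴴ * Kᴴ` have the
same trace. -/
theorem commute_or_anticommute_of_mul_eq_smul_mul {n : Type} [Fintype n]
    {A B : Matrix n n ℂ} (hA : A.IsHermitian) (hB : B.IsHermitian) (h0 : A * B ≠ 0) {l : ℂ}
    (h : A * B = l • (B * A)) : A * B = B * A ∨ A * B = -(B * A) := by
  have hK : (A * B)ᴴ = B * A := by rw [conjTranspose_mul, hA.eq, hB.eq]
  have hK' : (B * A)ᴴ = A * B := by rw [← hK, conjTranspose_conjTranspose]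
  have h' : B * A = star l • (A * B) := by
    rw [← hK, h, conjTranspose_smul, hK', ← h]
  have hnorm : l * star l = 1 := by
    by_contra hne
    refine h0 ((smul_eq_zero.1 (?_ : (1 - l * star l) • (A * B) = 0)).resolve_left
      (sub_ne_zero.2 (Ne.symm hne)))
    rw [sub_smul, one_smul, mul_smul, ← h', ← h, sub_self]
  have ht : trace ((A * B) * (B * A)) ≠ 0 := by
    rw [← hK]
    exact fun hz => h0 (trace_mul_conjTranspose_self_eq_zero_iff.1 hz)
  have h1 : trace ((A * B) * (A * B)) = l * trace ((A * B) * (B * A)) := by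
    rw [trace_mul_comm (A * B) (B * A), ← smul_eq_mul l, ← trace_smul, ← smul_mul, ← h]
  have h2 : trace ((B * A) * (B * A)) = star l * trace ((A * B) * (B * A)) := by
    rw [← smul_eq_mul (star l), ← trace_smul, ← smul_mul, ← h']
  have h3 : trace ((A * B) * (A * B)) = trace ((B * A) * (B * A)) := by
    rw [Matrix.mul_assoc, trace_mul_comm]
    simp only [Matrix.mul_assoc]
  have hl : l = star l := mul_right_cancel₀ ht (by rw [← h1, ← h2, h3])
  rw [← hl] at hnorm
  rcases mul_self_eq_one_iff.1 hnorm with rfl | rfl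
  · left; simpa using h
  · right; simpa using h

/-- Factors of equal non-vanishing product operators are proportional. -/
theorem exists_smul_of_tensorOp_eq {Q : Type} [Fintype Q] [DecidableEq Q] {d : Q → ℕ}
    {M N : (q : Q) → Matrix (Fin (d q)) (Fin (d q)) ℂ} (h : tensorOp M = tensorOp N)
    (hM : ∀ q, M q ≠ 0) (q : Q) : ∃ l : ℂ, M q = l • N q := by
  have hex : ∀ r, ∃ x y, M r x y ≠ 0 := fun r => by
    by_contra! hc
    exact hM r (Matrix.ext hc)
  choose x y hxy using hex
  have hP : ∏ r ∈ Finset.univ.erase q, M r (x r) (y r) ≠ 0 :=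
    Finset.prod_ne_zero_iff.2 fun r _ => hxy r
  refine ⟨(∏ r ∈ Finset.univ.erase q, N r (x r) (y r)) /
    ∏ r ∈ Finset.univ.erase q, M r (x r) (y r), ?_⟩
  ext s t
  have e := congrFun (congrFun h (Function.update x q s)) (Function.update y q t)
  simp only [tensorOp, Matrix.of_apply] at e
  have key : ∀ L : (q : Q) → Matrix (Fin (d q)) (Fin (d q)) ℂ,
      ∏ r, L r (Function.update x q s r) (Function.update y q t r) =
        L q s t * ∏ r ∈ Finset.univ.erase q, L r (x r) (y r) := fun L => by
    rw [← Finset.mul_prod_erase _ _ (Finset.mem_univ q)]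
    congr 1
    · simp
    · refine Finset.prod_congr rfl fun r hr => ?_
      rw [Function.update_of_ne (Finset.ne_of_mem_erase hr),
        Function.update_of_ne (Finset.ne_of_mem_erase hr)]
  rw [key, key] at e
  rw [Matrix.smul_apply, smul_eq_mul, div_mul_eq_mul_div, eq_div_iff hP, e, mul_comm]

/-- Two commuting products of Hermitian matrices annihilate each other in some factor, or their
factors commute or anticommute everywhere. -/
theorem exists_mul_eq_zero_or_commute_or_anticommute {Q : Type} [Fintype Q] [DecidableEq Q]
    {d : Q → ℕ} {A B : (q : Q) → Matrix (Fin (d q)) (Fin (d q)) ℂ}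
    (hA : ∀ q, (A q).IsHermitian) (hB : ∀ q, (B q).IsHermitian)
    (h : tensorOp A * tensorOp B = tensorOp B * tensorOp A) :
    (∃ q, A q * B q = 0) ∨ ∀ q, A q * B q = B q * A q ∨ A q * B q = -(B q * A q) := by
  by_cases h0 : ∃ q, A q * B q = 0
  · exact Or.inl h0
  · push Not at h0
    rw [tensorOp_mul, tensorOp_mul] at h
    refine Or.inr fun q => ?_
    obtain ⟨l, hl⟩ := exists_smul_of_tensorOp_eq h h0 q
    exact commute_or_anticommute_of_mul_eq_smul_mul (hA q) (hB q) (h0 q) hl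

end ProductOperators

/-! ### Absence of propagation on the open lattice -/

section Lattice

theorem mem_plaquetteVertices_iff {a b : ℕ} (p : LatticePlaquette a b) (q : LatticeVertex a b) :
    q ∈ plaquetteVertices p ↔
      ((q.1 : ℕ) = p.1 ∨ (q.1 : ℕ) = p.1 + 1) ∧ ((q.2 : ℕ) = p.2 ∨ (q.2 : ℕ) = p.2 + 1) := by
  obtain ⟨x, y⟩ := q
  simp only [plaquetteVertices, Set.mem_insert_iff, Set.mem_singleton_iff, Prod.mk.injEq,
    Fin.ext_iff, Fin.val_castSucc, Fin.val_succ]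
  tauto

/-- There is no nonempty symmetric relation `Z i j q` (`i` and `j` are related at the common point
`q` of `S i` and `S j`) that propagates as follows: if `i` and `j` are related at `q`, then `i` is
related to some third `k` with `q ∈ S k`, at a point `q' ≠ q`. -/
def NoPropagation {Q ι : Type} (S : ι → Set Q) : Prop :=
  ∀ Z : ι → ι → Q → Prop, (∀ i j q, Z i j q → Z j i q) → (∀ i j q, Z i j q → q ∈ S i) →
    (∀ i j q, Z i j q → ∃ k q', k ≠ i ∧ k ≠ j ∧ q' ≠ q ∧ q ∈ S k ∧ Z i k q') →
    ∀ i j q, ¬ Z i j q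

/-- In a lattice with open boundary, a propagating relation would have to leave the lattice.
The first step leads to a pair of plaquettes sharing an edge. Continued from the eastern one of two
horizontal neighbours, the relation moves one step east; continued from the southern one of two
vertical neighbours, it moves one step south. -/
theorem noPropagation_plaquetteVertices {a b : ℕ} :
    NoPropagation (plaquetteVertices : LatticePlaquette a b → Set (LatticeVertex a b)) := by
  intro Z symm supp step i j q
  -- `a + q.2 - q.1` decreases along the propagation
  have main : ∀ n (i j : LatticePlaquette a b) (q : LatticeVertex a b),
      ((i.1 : ℕ) = j.1 ∨ (i.2 : ℕ) = j.2) → i ≠ j → a + q.2 - q.1 ≤ n → ¬ Z i j q := by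
    intro n
    induction n with
    | zero =>
      intro i j q hij hne hn hZ
      have hi := (mem_plaquetteVertices_iff _ _).1 (supp _ _ _ hZ)
      have hj := (mem_plaquetteVertices_iff _ _).1 (supp _ _ _ (symm _ _ _ hZ))
      rw [Ne, Prod.ext_iff, Fin.ext_iff, Fin.ext_iff] at hne
      have := i.1.isLt
      have := j.1.isLt
      omega
    | succ n ih =>
      have key : ∀ (i j : LatticePlaquette a b) (q : LatticeVertex a b),
          ((i.1 : ℕ) = j.1 ∨ (i.2 : ℕ) = j.2) → i ≠ j → a + q.2 - q.1 ≤ n + 1 →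
          (i.1 : ℕ) + j.2 > j.1 + i.2 → ¬ Z i j q := by
        intro i j q hij hne hn hlt hZ
        obtain ⟨k, q', hki, hkj, hqq, hqk, hZ'⟩ := step _ _ _ hZ
        have hi := (mem_plaquetteVertices_iff _ _).1 (supp _ _ _ hZ)
        have hj := (mem_plaquetteVertices_iff _ _).1 (supp _ _ _ (symm _ _ _ hZ))
        have hk := (mem_plaquetteVertices_iff _ _).1 hqk
        have hi' := (mem_plaquetteVertices_iff _ _).1 (supp _ _ _ hZ')
        have hk' := (mem_plaquetteVertices_iff _ _).1 (supp _ _ _ (symm _ _ _ hZ'))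
        have hik := hki.symm
        rw [Ne, Prod.ext_iff, Fin.ext_iff, Fin.ext_iff] at hne hki hkj hqq
        have := q.1.isLt
        have := q'.1.isLt
        exact ih i k q' (by omega) hik (by omega) hZ'
      intro i j q hij hne hn hZ
      by_cases hlt : (i.1 : ℕ) + j.2 > j.1 + i.2
      · exact key i j q hij hne hn hlt hZ
      · refine key j i q (by omega) hne.symm hn ?_ (symm _ _ _ hZ)
        rw [Ne, Prod.ext_iff, Fin.ext_iff, Fin.ext_iff] at hne
        omega
  intro hZ
  obtain ⟨k, q', hki, hkj, hqq, hqk, hZ'⟩ := step _ _ _ hZ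
  have hi := (mem_plaquetteVertices_iff _ _).1 (supp _ _ _ hZ)
  have hk := (mem_plaquetteVertices_iff _ _).1 hqk
  have hi' := (mem_plaquetteVertices_iff _ _).1 (supp _ _ _ hZ')
  have hk' := (mem_plaquetteVertices_iff _ _).1 (supp _ _ _ (symm _ _ _ hZ'))
  refine main _ i k q' ?_ hki.symm le_rfl hZ'
  rw [Ne, Prod.ext_iff, Fin.ext_iff, Fin.ext_iff] at hqq
  omega

end Lattice

/-! ### Elements commuting up to sign -/

section CommuteUpToSign

/-- `a` and `b` commute or anticommute. -/
def CommuteUpToSign {R : Type*} [Ring R] (a b : R) : Prop :=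
  a * b = b * a ∨ a * b = -(b * a)

namespace CommuteUpToSign

variable {R : Type*} [Ring R] {a b c : R}

theorem refl (a : R) : CommuteUpToSign a a := Or.inl rfl

theorem one_left (a : R) : CommuteUpToSign 1 a := Or.inl (by simp)

theorem symm (h : CommuteUpToSign a b) : CommuteUpToSign b a := by
  rcases h with h | h
  · exact Or.inl h.symm
  · exact Or.inr (by rw [h, neg_neg])

theorem mul_left (ha : CommuteUpToSign a c) (hb : CommuteUpToSign b c) :
    CommuteUpToSign (a * b) c := by
  rcases ha with ha | ha <;> rcases hb with hb | hb
  · left; rw [mul_assoc, hb, ← mul_assoc, ha, mul_assoc]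
  · right; rw [mul_assoc, hb, mul_neg, ← mul_assoc, ha, mul_assoc]
  · right; rw [mul_assoc, hb, ← mul_assoc, ha, neg_mul, mul_assoc]
  · left; rw [mul_assoc, hb, mul_neg, ← mul_assoc, ha, neg_mul, neg_neg, mul_assoc]

theorem smul_left {S : Type*} [CommRing S] [Algebra S R] (h : CommuteUpToSign a b) (s : S) :
    CommuteUpToSign (s • a) b := by
  rcases h with h | h
  · left; rw [smul_mul_assoc, h, mul_smul_comm]
  · right; rw [smul_mul_assoc, h, mul_smul_comm, smul_neg]

/-- The square of an element commutes with everything that the element commutes with up to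
sign. -/
theorem mul_self_mul (h : CommuteUpToSign a b) : a * a * b = b * (a * a) := by
  rcases h with h | h
  · rw [mul_assoc, h, ← mul_assoc, h, mul_assoc]
  · rw [mul_assoc, h, mul_neg, ← mul_assoc, h, neg_mul, neg_neg, mul_assoc]

end CommuteUpToSign

end CommuteUpToSign

/-! ### Irreducible families of operators -/

section Irreducible

variable {E : Type} [NormedAddCommGroup E] [InnerProductSpace ℂ E] {ι : Type}

/-- The family `T` of operators has no invariant subspaces except `⊥` and `⊤`. -/
def IsIrreducibleFamily (T : ι → Module.End ℂ E) : Prop :=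
  ∀ W : Submodule ℂ E, (∀ i, ∀ v ∈ W, T i v ∈ W) → W = ⊥ ∨ W = ⊤

/-- Schur's lemma. -/
theorem IsIrreducibleFamily.exists_smul [FiniteDimensional ℂ E] [Nontrivial E]
    {T : ι → Module.End ℂ E} (hT : IsIrreducibleFamily T) {S : Module.End ℂ E}
    (hS : ∀ i, S * T i = T i * S) : ∃ μ : ℂ, ∀ v, S v = μ • v := by
  obtain ⟨μ, hμ⟩ := Module.End.exists_eigenvalue S
  have hinv : ∀ i, ∀ v ∈ Module.End.eigenspace S μ, T i v ∈ Module.End.eigenspace S μ := by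
    intro i v hv
    rw [Module.End.mem_eigenspace_iff] at hv ⊢
    rw [← Module.End.mul_apply, hS, Module.End.mul_apply, hv, map_smul]
  rcases hT _ hinv with h | h
  · exact absurd h hμ
  · exact ⟨μ, fun v => Module.End.mem_eigenspace_iff.1 (h ▸ Submodule.mem_top)⟩

/-- Schur's lemma for symmetric operators: the scalar is real. -/
theorem IsIrreducibleFamily.exists_real_smul [FiniteDimensional ℂ E] [Nontrivial E]
    {T : ι → Module.End ℂ E} (hT : IsIrreducibleFamily T) {S : Module.End ℂ E}
    (hsym : S.IsSymmetric) (hS : ∀ i, S * T i = T i * S) :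
    ∃ t : ℝ, ∀ v, S v = (t : ℂ) • v := by
  obtain ⟨μ, hμ⟩ := hT.exists_smul hS
  obtain ⟨v, hv⟩ := exists_ne (0 : E)
  have hev : Module.End.HasEigenvalue S μ :=
    Module.End.hasEigenvalue_of_hasEigenvector ⟨Module.End.mem_eigenspace_iff.2 (hμ v), hv⟩
  refine ⟨μ.re, fun w => ?_⟩
  rw [hμ, Complex.conj_eq_iff_re.1 (hsym.conj_eigenvalue_eq_self hev)]

theorem LinearMap.IsSymmetric.mul_of_comm {S T : Module.End ℂ E} (hS : S.IsSymmetric)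
    (hT : T.IsSymmetric) (h : S * T = T * S) : (S * T).IsSymmetric := fun v w => by
  rw [Module.End.mul_apply, hS, hT, ← Module.End.mul_apply, ← h]

end Irreducible


section SymmetricOperators

variable {E : Type} [NormedAddCommGroup E] [InnerProductSpace ℂ E]

theorem LinearMap.IsSymmetric.mul_eq_zero_comm {S T : Module.End ℂ E} (hS : S.IsSymmetric)
    (hT : T.IsSymmetric) (h : S * T = 0) : T * S = 0 := by
  refine LinearMap.ext fun v => ext_inner_right ℂ fun w => ?_
  rw [Module.End.mul_apply, hT, hS, ← Module.End.mul_apply, h]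
  simp

theorem LinearMap.IsSymmetric.eq_zero_of_mul_self {S : Module.End ℂ E} (hS : S.IsSymmetric)
    (h : S * S = 0) : S = 0 := by
  refine LinearMap.ext fun v => inner_self_eq_zero.1 (?_ : inner ℂ (S v) (S v) = 0)
  rw [hS, ← Module.End.mul_apply, h]
  simp

/-- In an irreducible family of symmetric operators, two non-zero members annihilate each other
only if the first one fails to commute up to sign with some member; otherwise its square would be
a non-zero scalar. -/
theorem IsIrreducibleFamily.exists_not_commuteUpToSign [FiniteDimensional ℂ E] [Nontrivial E]
    {ι : Type} {T : ι → Module.End ℂ E} (hT : IsIrreducibleFamily T)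
    (hsym : ∀ i, (T i).IsSymmetric) (hne : ∀ i, T i ≠ 0) {i j : ι} (h : T i * T j = 0) :
    ∃ k, ¬ CommuteUpToSign (T i) (T k) := by
  by_contra! hc
  obtain ⟨t, ht⟩ := hT.exists_smul fun k => (hc k).mul_self_mul
  have ht0 : t ≠ 0 := by
    rintro rfl
    exact hne i ((hsym i).eq_zero_of_mul_self (LinearMap.ext fun v => by simpa using ht v))
  refine hne j (LinearMap.ext fun v => (smul_eq_zero.1 ?_).resolve_left ht0)
  rw [← ht, Module.End.mul_apply, ← Module.End.mul_apply (T i) (T j), h]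
  simp

end SymmetricOperators

/-! ### Splitting off a qubit -/

section QubitSplitting

variable {E : Type} [NormedAddCommGroup E] [InnerProductSpace ℂ E] {X Z : Module.End ℂ E}

/-- The operators playing the roles of the Pauli matrices, for given anticommuting involutions
`X` and `Z`. -/
def pauliEnd (X Z : Module.End ℂ E) : PauliLabel → Module.End ℂ E
  | PauliLabel.I => 1
  | PauliLabel.X => X
  | PauliLabel.Y => Complex.I • (X * Z)
  | PauliLabel.Z => Z

theorem pauliEnd_mul_self (hX : X * X = 1) (hZ : Z * Z = 1) (hZX : Z * X = -(X * Z))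
    (p : PauliLabel) : pauliEnd X Z p * pauliEnd X Z p = 1 := by
  cases p
  · simp [pauliEnd]
  · exact hX
  · have : X * Z * (X * Z) = -1 := by
      rw [mul_assoc, ← mul_assoc Z, hZX, neg_mul, mul_assoc, hZ, mul_one, mul_neg, hX]
    simp [pauliEnd, smul_smul, this]
  · exact hZ

theorem isSymmetric_pauliEnd (sX : X.IsSymmetric) (sZ : Z.IsSymmetric) (hZX : Z * X = -(X * Z))
    (p : PauliLabel) : (pauliEnd X Z p).IsSymmetric := by
  cases p
  · exact LinearMap.IsSymmetric.id
  · exact sX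
  · intro v w
    have h : Z (X w) = -(X (Z w)) := LinearMap.congr_fun hZX w
    simp only [pauliEnd, LinearMap.smul_apply, Module.End.mul_apply, inner_smul_left,
      inner_smul_right]
    rw [sX, sZ, h]
    simp
  · exact sZ

theorem CommuteUpToSign.pauliEnd_left {T : Module.End ℂ E} (hX : CommuteUpToSign X T)
    (hZ : CommuteUpToSign Z T) (p : PauliLabel) : CommuteUpToSign (pauliEnd X Z p) T := by
  cases p
  · exact CommuteUpToSign.one_left T
  · exact hX
  · exact (hX.mul_left hZ).smul_left _
  · exact hZ

/-- An operator commuting up to sign with `X` and `Z` commutes with both after multiplication by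
a suitable one of the Pauli operators, which moreover commutes with it. -/
theorem exists_pauliEnd_commute (hZX : Z * X = -(X * Z))
    {T : Module.End ℂ E} (hTX : CommuteUpToSign T X) (hTZ : CommuteUpToSign T Z) :
    ∃ p, T * pauliEnd X Z p = pauliEnd X Z p * T ∧
      T * pauliEnd X Z p * X = X * (T * pauliEnd X Z p) ∧
      T * pauliEnd X Z p * Z = Z * (T * pauliEnd X Z p) := by
  have hZX' : ∀ S : Module.End ℂ E, Z * (X * S) = -(X * (Z * S)) := fun S => by
    rw [← mul_assoc, hZX, neg_mul, mul_assoc]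
  rcases hTX with hTX | hTX <;> rcases hTZ with hTZ | hTZ
  all_goals
    have hTX' : ∀ S : Module.End ℂ E, T * (X * S) = _ * S := fun S => by
      rw [← mul_assoc, hTX]
  · refine ⟨PauliLabel.I, ?_, ?_, ?_⟩ <;> simp [pauliEnd, hTX, hTZ]
  · refine ⟨PauliLabel.X, ?_, ?_, ?_⟩ <;>
      simp [pauliEnd, hTX, hTZ, hZX', mul_assoc]
  · refine ⟨PauliLabel.Z, ?_, ?_, ?_⟩
    · exact hTZ
    · simp [pauliEnd, mul_assoc, hZX, hTX']
    · simp [pauliEnd, mul_assoc, hTZ]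
  · refine ⟨PauliLabel.Y, ?_, ?_, ?_⟩ <;>
      simp [pauliEnd, hTX, hTZ, hTX', hZX', mul_assoc]

variable (X Z) in
/-- The two embeddings of the `1`-eigenspace of `Z`: the inclusion, onto the `1`-eigenspace, and
`X`, onto the `-1`-eigenspace. They identify the whole space with the tensor product of a qubit
and the `1`-eigenspace. -/
def splitEmbedding (b : Fin 2) : LinearMap.eqLocus Z (1 : Module.End ℂ E) →ₗ[ℂ] E :=
  if b = 0 then Submodule.subtype _ else X ∘ₗ Submodule.subtype _

theorem splitEmbedding_zero (v : LinearMap.eqLocus Z (1 : Module.End ℂ E)) :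
    splitEmbedding X Z 0 v = v := by simp [splitEmbedding]

theorem splitEmbedding_one (v : LinearMap.eqLocus Z (1 : Module.End ℂ E)) :
    splitEmbedding X Z 1 v = X v := by simp [splitEmbedding]

theorem apply_eqLocus_one (v : LinearMap.eqLocus Z (1 : Module.End ℂ E)) : Z v = v := v.2

theorem pauliEnd_splitEmbedding (hX : X * X = 1) (hZX : Z * X = -(X * Z)) (p : PauliLabel)
    (b : Fin 2) (v : LinearMap.eqLocus Z (1 : Module.End ℂ E)) :
    pauliEnd X Z p (splitEmbedding X Z b v) =
      ∑ b', p.toMatrix b' b • splitEmbedding X Z b' v := by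
  have hX' : ∀ w, X (X w) = w := fun w => LinearMap.congr_fun hX w
  have hZX' : ∀ w, Z (X w) = -(X (Z w)) := fun w => LinearMap.congr_fun hZX w
  have hv := apply_eqLocus_one v
  obtain rfl | rfl : b = 0 ∨ b = 1 := by omega
  all_goals cases p <;>
    simp [pauliEnd, PauliLabel.toMatrix, splitEmbedding_zero, splitEmbedding_one, hX', hZX', hv]

theorem inner_splitEmbedding (hX : X * X = 1) (hZX : Z * X = -(X * Z))
    (sX : X.IsSymmetric) (sZ : Z.IsSymmetric) (b c : Fin 2)
    (v w : LinearMap.eqLocus Z (1 : Module.End ℂ E)) :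
    inner ℂ (splitEmbedding X Z b v) (splitEmbedding X Z c w) =
      if b = c then inner ℂ v w else 0 := by
  have hX' : ∀ w, X (X w) = w := fun w => LinearMap.congr_fun hX w
  have hZX' : ∀ w, Z (X w) = -(X (Z w)) := fun w => LinearMap.congr_fun hZX w
  have h0 : ∀ v w : LinearMap.eqLocus Z (1 : Module.End ℂ E), inner ℂ (v : E) (X w) = 0 := by
    intro v w
    have : inner ℂ (v : E) (X w) = -inner ℂ (v : E) (X w) := by
      conv_lhs => rw [← apply_eqLocus_one v, sZ, hZX', apply_eqLocus_one, inner_neg_right]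
    exact self_eq_neg.1 this
  fin_cases b <;> fin_cases c <;>
    simp [splitEmbedding_zero, splitEmbedding_one, h0, sX _ _, hX']

theorem exists_eq_splitEmbedding_add (hX : X * X = 1) (hZ : Z * Z = 1) (hZX : Z * X = -(X * Z))
    (v : E) : ∃ v₀ v₁, v = splitEmbedding X Z 0 v₀ + splitEmbedding X Z 1 v₁ := by
  have hX' : ∀ w, X (X w) = w := fun w => LinearMap.congr_fun hX w
  have hZ' : ∀ w, Z (Z w) = w := fun w => LinearMap.congr_fun hZ w
  have hZX' : ∀ w, Z (X w) = -(X (Z w)) := fun w => LinearMap.congr_fun hZX w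
  refine ⟨⟨(2⁻¹ : ℂ) • (v + Z v), ?_⟩, ⟨(2⁻¹ : ℂ) • X (v - Z v), ?_⟩, ?_⟩
  · simp [LinearMap.mem_eqLocus, hZ', add_comm]
  · simp only [LinearMap.mem_eqLocus, map_smul, hZX', map_sub, hZ', Module.End.one_apply]
    congr 1
    abel
  · simp only [splitEmbedding_zero, splitEmbedding_one, map_smul, hX']
    rw [← smul_add, add_add_sub_cancel, ← two_smul ℂ v, smul_smul]
    simp

/-- If a family of operators is irreducible and consists of products of Pauli operators with
operators `R i` commuting with `X` and `Z`, the restrictions of the `R i` to the `1`-eigenspace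
of `Z` are irreducible: if `W` is invariant, so is `W ⊔ X W`. -/
theorem isIrreducibleFamily_restrict {ι : Type} {T R : ι → Module.End ℂ E}
    (hT : IsIrreducibleFamily T) (hX : X * X = 1) (hZX : Z * X = -(X * Z))
    (p : ι → PauliLabel) (hTR : ∀ i, T i = R i * pauliEnd X Z (p i))
    (hRX : ∀ i, R i * X = X * R i)
    (hR : ∀ i, ∀ v ∈ LinearMap.eqLocus Z (1 : Module.End ℂ E),
      R i v ∈ LinearMap.eqLocus Z (1 : Module.End ℂ E)) :
    IsIrreducibleFamily fun i => (R i).restrict (hR i) := by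
  intro W hW
  have hRX' : ∀ i w, R i (X w) = X (R i w) := fun i w => LinearMap.congr_fun (hRX i) w
  -- `W ⊔ X W`
  set M : Submodule ℂ E := ⨆ b, W.map (splitEmbedding X Z b) with hM
  have hmem : ∀ b, ∀ w ∈ W, splitEmbedding X Z b w ∈ M := fun b w hw =>
    Submodule.mem_iSup_of_mem b (Submodule.mem_map_of_mem hw)
  have hRemb : ∀ i b w, R i (splitEmbedding X Z b w) =
      splitEmbedding X Z b ((R i).restrict (hR i) w) := by
    intro i b w
    fin_cases b <;> simp [splitEmbedding_zero, splitEmbedding_one, hRX']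
  have hinv : ∀ i, ∀ v ∈ M, T i v ∈ M := by
    intro i
    suffices M ≤ M.comap (T i) from this
    refine iSup_le fun b => ?_
    rintro _ ⟨w, hw, rfl⟩
    rw [Submodule.mem_comap, hTR, Module.End.mul_apply, pauliEnd_splitEmbedding hX hZX, map_sum]
    refine Submodule.sum_mem _ fun b' _ => ?_
    rw [map_smul, hRemb]
    exact M.smul_mem _ (hmem _ _ (hW i w hw))
  rcases hT M hinv with h | h
  · left
    refine (Submodule.eq_bot_iff _).2 fun w hw => ?_
    have := hmem 0 w hw
    rw [h, Submodule.mem_bot, splitEmbedding_zero] at this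
    exact Subtype.ext this
  · right
    refine (Submodule.eq_top_iff'.2 fun v => ?_)
    have hv : splitEmbedding X Z 0 v ∈ M := h ▸ Submodule.mem_top
    rw [hM, Submodule.mem_iSup_iff_exists_finsupp] at hv
    obtain ⟨f, hf, hsum⟩ := hv
    rw [Finsupp.sum_fintype _ _ (fun _ => rfl), Fin.sum_univ_two] at hsum
    obtain ⟨w₀, hw₀, e₀⟩ := hf 0
    obtain ⟨w₁, hw₁, e₁⟩ := hf 1
    rw [← e₀, ← e₁] at hsum
    have hZX' : ∀ w, Z (X w) = -(X (Z w)) := fun w => LinearMap.congr_fun hZX w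
    rw [splitEmbedding_zero, splitEmbedding_one, splitEmbedding_zero] at hsum
    -- the component in the `-1`-eigenspace vanishes
    have hZv := congrArg Z hsum
    rw [map_add, hZX', apply_eqLocus_one, apply_eqLocus_one, apply_eqLocus_one, ← hsum] at hZv
    have h1 : X (w₁ : E) = 0 := by
      refine (smul_eq_zero.1 (?_ : (2 : ℂ) • X (w₁ : E) = 0)).resolve_left two_ne_zero
      rw [two_smul]
      nth_rewrite 1 [← add_left_cancel hZv]
      exact neg_add_cancel _
    rw [h1, add_zero] at hsum
    rwa [← Subtype.ext hsum]

end QubitSplitting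

/-! ### Pauli strings from irreducible families -/

section PauliBasis

theorem commuteUpToSign_restrict {E : Type} [AddCommGroup E] [Module ℂ E]
    {P : Submodule ℂ E} {A B : Module.End ℂ E} (hA : ∀ v ∈ P, A v ∈ P) (hB : ∀ v ∈ P, B v ∈ P)
    (h : (∀ v ∈ P, A (B v) = B (A v)) ∨ ∀ v ∈ P, A (B v) = -B (A v)) :
    CommuteUpToSign (R := Module.End ℂ P) (A.restrict hA) (B.restrict hB) :=
  h.imp (fun h => LinearMap.ext fun v => Subtype.ext (h v v.2))
    (fun h => LinearMap.ext fun v => Subtype.ext (h v v.2))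

theorem pauliString_cons {m : ℕ} (p : PauliLabel) (s : Fin m → PauliLabel) (b b' : Fin 2)
    (x y : Fin m → Fin 2) :
    pauliString (Fin.cons p s : Fin (m + 1) → PauliLabel) (Fin.cons b x : Fin (m + 1) → Fin 2)
      (Fin.cons b' y : Fin (m + 1) → Fin 2) = p.toMatrix b b' * pauliString s x y := by
  simp [pauliString, tensorOp, Fin.prod_univ_succ]

theorem pauliString_zero (s : Fin 0 → PauliLabel) : pauliString s = 1 := by
  ext x y
  rw [Subsingleton.elim x y, Matrix.one_apply_eq]
  simp [pauliString, tensorOp]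

theorem sum_fin_succ_fun {M : Type*} [AddCommMonoid M] {m : ℕ} (f : (Fin (m + 1) → Fin 2) → M) :
    ∑ y, f y = ∑ b, ∑ y : Fin m → Fin 2, f (Fin.cons b y) := by
  rw [← Fintype.sum_prod_type' (f := fun b y => f (Fin.cons b y))]
  exact (Fintype.sum_equiv (Fin.consEquiv fun _ => Fin 2) _ _ fun _ => rfl).symm

/-- In the presence of anticommuting symmetric involutions `X` and `Z`, an orthonormal basis of
the `1`-eigenspace of `Z` labelled by bit strings extends, by one more bit, to the whole
space. -/
theorem exists_orthonormalBasis_splitEmbedding {E : Type} [NormedAddCommGroup E]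
    [InnerProductSpace ℂ E] {X Z : Module.End ℂ E} (hX : X * X = 1)
    (hZ : Z * Z = 1) (hZX : Z * X = -(X * Z)) (sX : X.IsSymmetric) (sZ : Z.IsSymmetric) {m : ℕ}
    (f : OrthonormalBasis (Fin m → Fin 2) ℂ (LinearMap.eqLocus Z (1 : Module.End ℂ E))) :
    ∃ e : OrthonormalBasis (Fin (m + 1) → Fin 2) ℂ E,
      ∀ b x, e (Fin.cons b x : Fin (m + 1) → Fin 2) = splitEmbedding X Z b (f x) := by
  have hon : Orthonormal ℂ fun x : Fin (m + 1) → Fin 2 =>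
      splitEmbedding X Z (x 0) (f (Fin.tail x)) := by
    rw [orthonormal_iff_ite]
    intro x y
    rw [inner_splitEmbedding hX hZX sX sZ, orthonormal_iff_ite.1 f.orthonormal]
    by_cases h0 : x 0 = y 0 <;> by_cases ht : Fin.tail x = Fin.tail y
    · have : x = y := by rw [← Fin.cons_self_tail x, ← Fin.cons_self_tail y, h0, ht]
      simp [this]
    · have : x ≠ y := fun h => ht (h ▸ rfl)
      simp [this, ht]
    · have : x ≠ y := fun h => h0 (h ▸ rfl)
      simp [this, h0]
    · have : x ≠ y := fun h => h0 (h ▸ rfl)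
      simp [this, h0]
  have hmem : ∀ b v, splitEmbedding X Z b v ∈ Submodule.span ℂ
      (Set.range fun x : Fin (m + 1) → Fin 2 => splitEmbedding X Z (x 0) (f (Fin.tail x))) := by
    intro b v
    rw [← f.sum_repr v, map_sum]
    refine Submodule.sum_mem _ fun x _ => ?_
    rw [map_smul]
    refine Submodule.smul_mem _ _ (Submodule.subset_span ⟨Fin.cons b x, ?_⟩)
    simp
  refine ⟨OrthonormalBasis.mk hon fun v _ => ?_, fun b x => by simp⟩
  obtain ⟨v₀, v₁, rfl⟩ := exists_eq_splitEmbedding_add hX hZ hZX v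
  exact Submodule.add_mem _ (hmem 0 v₀) (hmem 1 v₁)

/-- An irreducible family of symmetric involutions, any two of which commute or anticommute,
consists of multiples of Pauli strings in a suitable orthonormal basis. If all of them commute,
the space is one-dimensional by Schur's lemma. Otherwise two of them, `Z` and `X`, anticommute and
split off one qubit: multiplied by suitable Pauli operators of this qubit, the members of the
family act on the `1`-eigenspace of `Z`, and there they again form an irreducible family. -/
theorem exists_pauli_orthonormalBasis {ι : Type} (n : ℕ) :
    ∀ (E : Type) [NormedAddCommGroup E] [InnerProductSpace ℂ E] [FiniteDimensional ℂ E]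
      [Nontrivial E] (T : ι → Module.End ℂ E), Module.finrank ℂ E ≤ n →
      (∀ i, (T i).IsSymmetric) → (∀ i, T i * T i = 1) →
      (∀ i j, CommuteUpToSign (T i) (T j)) → IsIrreducibleFamily T →
      ∃ (m : ℕ) (e : OrthonormalBasis (Fin m → Fin 2) ℂ E), ∀ i,
        ∃ (c : ℝ) (s : Fin m → PauliLabel), ∀ x,
          T i (e x) = (c : ℂ) • ∑ y, pauliString s y x • e y := by
  induction n with
  | zero =>
    intro E _ _ _ _ T hn
    exact absurd hn (Nat.not_le.2 Module.finrank_pos)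
  | succ n ih =>
    intro E _ _ _ _ T hn hsym hinv hcomm hirr
    by_cases hall : ∀ i j, T i * T j = T j * T i
    · choose c hc using fun i => hirr.exists_real_smul (hsym i) (hall i)
      have hdim : Module.finrank ℂ E = 1 := by
        obtain ⟨v, hv⟩ := exists_ne (0 : E)
        rcases hirr (ℂ ∙ v) fun i w hw => by rw [hc]; exact Submodule.smul_mem _ _ hw with h | h
        · exact absurd (Submodule.span_singleton_eq_bot.1 h) hv
        · rw [← finrank_top ℂ E, ← h, finrank_span_singleton hv]
      refine ⟨0, (stdOrthonormalBasis ℂ E).reindex (Fintype.equivOfCardEq (by simp [hdim])),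
        fun i => ⟨c i, fun _ => PauliLabel.I, fun x => ?_⟩⟩
      rw [hc, pauliString_zero,
        Fintype.sum_eq_single x fun y hy => absurd (Subsingleton.elim y x) hy,
        Matrix.one_apply_eq, one_smul]
    · push Not at hall
      obtain ⟨i₀, j₀, hne⟩ := hall
      set Z := T i₀
      set X := T j₀
      have hX : X * X = 1 := hinv j₀
      have hZ : Z * Z = 1 := hinv i₀
      have sX : X.IsSymmetric := hsym j₀
      have sZ : Z.IsSymmetric := hsym i₀
      have hZX : Z * X = -(X * Z) := (hcomm i₀ j₀).resolve_left hne
      choose p hp hpX hpZ using fun i =>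
        exists_pauliEnd_commute hZX (hcomm i j₀) (hcomm i i₀)
      have hp2 := pauliEnd_mul_self hX hZ hZX
      have hpT : ∀ i k, CommuteUpToSign (pauliEnd X Z (p i)) (T k) := fun i k =>
        (hcomm j₀ k).pauliEnd_left (hcomm i₀ k) (p i)
      have hpp : ∀ i k, CommuteUpToSign (pauliEnd X Z (p i)) (pauliEnd X Z (p k)) := fun i k =>
        (CommuteUpToSign.pauliEnd_left (hpT k j₀).symm (hpT k i₀).symm (p i))
      -- the operators `R i` act on the complement of the qubit
      set R : ι → Module.End ℂ E := fun i => T i * pauliEnd X Z (p i) with hR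
      have hTR : ∀ i, T i = R i * pauliEnd X Z (p i) := fun i => by
        rw [hR, mul_assoc, hp2, mul_one]
      have hRsym : ∀ i, (R i).IsSymmetric := fun i =>
        (hsym i).mul_of_comm (isSymmetric_pauliEnd sX sZ hZX _) (hp i)
      have hRinv : ∀ i, R i * R i = 1 := fun i => by
        simp only [hR]
        nth_rewrite 2 [hp i]
        rw [mul_assoc, ← mul_assoc (pauliEnd X Z (p i)), hp2, one_mul, hinv]
      have hRcomm : ∀ i k, CommuteUpToSign (R i) (R k) := fun i k =>
        ((((hcomm i k).mul_left (hpT i k)).symm).mul_left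
          (((hpT k i).symm).mul_left (hpp i k)).symm).symm
      have hmaps : ∀ i, ∀ v ∈ LinearMap.eqLocus Z (1 : Module.End ℂ E),
          R i v ∈ LinearMap.eqLocus Z (1 : Module.End ℂ E) := fun i v hv => by
        rw [LinearMap.mem_eqLocus] at hv ⊢
        rw [← Module.End.mul_apply, ← hpZ i, Module.End.mul_apply, hv]
        rfl
      have hne_top : LinearMap.eqLocus Z (1 : Module.End ℂ E) ≠ ⊤ := fun h => hne (by
        rw [LinearMap.eqLocus_eq_top.1 h]
        simp)
      have hnontriv : Nontrivial (LinearMap.eqLocus Z (1 : Module.End ℂ E)) := by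
        by_contra hsub
        rw [not_nontrivial_iff_subsingleton] at hsub
        obtain ⟨v, hv⟩ := exists_ne (0 : E)
        obtain ⟨v₀, v₁, h⟩ := exists_eq_splitEmbedding_add hX hZ hZX v
        rw [Subsingleton.elim v₀ 0, Subsingleton.elim v₁ 0, map_zero, map_zero, add_zero] at h
        exact hv h
      obtain ⟨m, f, hf⟩ := ih (LinearMap.eqLocus Z (1 : Module.End ℂ E))
        (fun i => (R i).restrict (hmaps i))
        (Nat.le_of_lt_succ ((Submodule.finrank_lt hne_top).trans_le hn))
        (fun i => (hRsym i).restrict_invariant (hmaps i))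
        (fun i => LinearMap.ext fun v => Subtype.ext (LinearMap.congr_fun (hRinv i) v))
        (fun i k => commuteUpToSign_restrict (hmaps i) (hmaps k) <| (hRcomm i k).imp
          (fun h v _ => LinearMap.congr_fun h v) (fun h v _ => LinearMap.congr_fun h v))
        (isIrreducibleFamily_restrict hirr hX hZX p hTR hpX hmaps)
      obtain ⟨e, he⟩ := exists_orthonormalBasis_splitEmbedding hX hZ hZX sX sZ f
      refine ⟨m + 1, e, fun i => ?_⟩
      obtain ⟨c, s, hcs⟩ := hf i
      refine ⟨c, Fin.cons (p i) s, fun x => ?_⟩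
      have hRX : ∀ w, R i (X w) = X (R i w) := fun w => LinearMap.congr_fun (hpX i) w
      have hRemb : ∀ b w, R i (splitEmbedding X Z b w) =
          splitEmbedding X Z b ((R i).restrict (hmaps i) w) := by
        intro b w
        obtain rfl | rfl : b = 0 ∨ b = 1 := by omega
        · simp [splitEmbedding_zero]
        · simp [splitEmbedding_one, hRX]
      rw [← Fin.cons_self_tail x, he, hTR i, Module.End.mul_apply,
        pauliEnd_splitEmbedding hX hZX, map_sum, sum_fin_succ_fun, Finset.smul_sum]
      refine Finset.sum_congr rfl fun b _ => ?_
      rw [map_smul, hRemb, hcs, map_smul, map_sum, smul_comm]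
      congr 1
      rw [Finset.smul_sum]
      refine Finset.sum_congr rfl fun y _ => ?_
      rw [he, pauliString_cons, map_smul, smul_smul]

/-- An irreducible family of non-zero symmetric operators, any two of which commute or
anticommute, consists of real multiples of Pauli strings under a suitable unitary identification
with a space of qubits. By Schur's lemma the squares are scalars, so that the operators are
multiples of involutions. -/
theorem exists_qubitSpace_equiv {ι E : Type} [NormedAddCommGroup E] [InnerProductSpace ℂ E]
    [FiniteDimensional ℂ E] [Nontrivial E] {T : ι → Module.End ℂ E}
    (hsym : ∀ i, (T i).IsSymmetric) (hne : ∀ i, T i ≠ 0)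
    (hcomm : ∀ i j, CommuteUpToSign (T i) (T j)) (hirr : IsIrreducibleFamily T) :
    ∃ (m : ℕ) (U : QubitSpace m ≃ₗᵢ[ℂ] E), ∀ i, ∃ (c : ℝ) (s : Fin m → PauliLabel),
      ∀ ψ, T i (U ψ) = (c : ℂ) • U (applyOp (pauliString s) ψ) := by
  choose t ht using fun i => hirr.exists_real_smul ((hsym i).mul_of_comm (hsym i) rfl)
    fun j => (hcomm i j).mul_self_mul
  have htpos : ∀ i, 0 < t i := fun i => by
    obtain ⟨v, hv⟩ : ∃ v, T i v ≠ 0 := by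
      by_contra! h
      exact hne i (LinearMap.ext h)
    have hv0 : v ≠ 0 := fun h => hv (by rw [h, map_zero])
    have h1 : ((‖T i v‖ ^ 2 : ℝ) : ℂ) = ((t i * ‖v‖ ^ 2 : ℝ) : ℂ) := by
      have h2 := hsym i v (T i v)
      rw [← Module.End.mul_apply, ht, inner_smul_right, inner_self_eq_norm_sq_to_K,
        inner_self_eq_norm_sq_to_K] at h2
      push_cast
      exact h2
    have h3 : ‖T i v‖ ^ 2 = t i * ‖v‖ ^ 2 := Complex.ofReal_injective h1
    have h4 : 0 < ‖T i v‖ ^ 2 := by positivity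
    rw [h3] at h4
    exact pos_of_mul_pos_left h4 (by positivity)
  have hroot : ∀ i, ((Real.sqrt (t i) : ℝ) : ℂ) ≠ 0 := fun i =>
    Complex.ofReal_ne_zero.2 (Real.sqrt_pos.2 (htpos i)).ne'
  -- normalization to involutions
  set S : ι → Module.End ℂ E := fun i => ((Real.sqrt (t i) : ℝ) : ℂ)⁻¹ • T i with hS
  have hTS : ∀ i v, T i v = ((Real.sqrt (t i) : ℝ) : ℂ) • S i v := fun i v => by
    simp only [hS, LinearMap.smul_apply]
    rw [smul_smul, mul_inv_cancel₀ (hroot i), one_smul]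
  obtain ⟨m, e, he⟩ := exists_pauli_orthonormalBasis (ι := ι) _ E S le_rfl
    (fun i v w => by
      simp only [hS, LinearMap.smul_apply, inner_smul_left, inner_smul_right, hsym i v w,
        ← Complex.ofReal_inv, Complex.conj_ofReal])
    (fun i => LinearMap.ext fun v => by
      have h := ht i v
      rw [Module.End.mul_apply] at h
      simp only [hS, Module.End.mul_apply, LinearMap.smul_apply, map_smul, h, smul_smul,
        Module.End.one_apply]
      rw [← mul_assoc, ← mul_inv, ← Complex.ofReal_mul, Real.mul_self_sqrt (htpos i).le,
        inv_mul_cancel₀ (Complex.ofReal_ne_zero.2 (htpos i).ne'), one_smul])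
    (fun i j => (((hcomm i j).smul_left _).symm.smul_left _).symm)
    (fun W hW => hirr W fun i v hv => by
      rw [hTS]
      exact W.smul_mem _ (hW i v hv))
  refine ⟨m, e.repr.symm, fun i => ?_⟩
  obtain ⟨c, s, hcs⟩ := he i
  refine ⟨Real.sqrt (t i) * c, s, fun ψ => ?_⟩
  rw [hTS, ← e.sum_repr_symm, ← e.sum_repr_symm, map_sum, Complex.ofReal_mul, mul_smul]
  congr 1
  simp only [map_smul, hcs, applyOp, Matrix.mulVec, dotProduct, Finset.sum_smul, Finset.smul_sum]
  rw [Finset.sum_comm]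
  refine Finset.sum_congr rfl fun y _ => Finset.sum_congr rfl fun x _ => ?_
  rw [smul_smul, smul_smul, smul_smul]
  congr 1
  ring

end PauliBasis

/-! ### Decomposition into simple subspaces -/

section Bricks

variable {Q : Type} [Fintype Q] [DecidableEq Q] {d : Q → ℕ} {ι : Type}

/-- On the simple subspace `⨂_q V q`, the operators `h i` act as `c i • ⨂_q T i q`, where the
symmetric operators `T i q` preserve `V q` and are trivial for `q ∉ S i`. Commutation of the terms
enters only through its consequence for the factors: for any two terms, some factors annihilate
each other on `V q`, or all factors commute or anticommute there. Unlike commutation on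
`⨂_q V q`, this property is local in `q`. -/
structure IsBrick (S : ι → Set Q) (h : ι → QuditOp d)
    (V : (q : Q) → Submodule ℂ (EuclideanSpace ℂ (Fin (d q))))
    (T : ι → (q : Q) → Module.End ℂ (EuclideanSpace ℂ (Fin (d q)))) (c : ι → ℝ) : Prop where
  symm : ∀ i q, (T i q).IsSymmetric
  maps : ∀ i q, ∀ v ∈ V q, T i q v ∈ V q
  supp : ∀ i, ∀ q ∉ S i, T i q = 1
  act : ∀ i (v : (q : Q) → EuclideanSpace ℂ (Fin (d q))), (∀ q, v q ∈ V q) →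
    applyOp (h i) (tensorVec v) = (c i : ℂ) • tensorVec fun q => T i q (v q)
  comm : ∀ i j, (∃ q, ∀ v ∈ V q, T i q (T j q v) = 0) ∨
    ∀ q, (∀ v ∈ V q, T i q (T j q v) = T j q (T i q v)) ∨
      ∀ v ∈ V q, T i q (T j q v) = -T j q (T i q v)

namespace IsBrick

variable {S : ι → Set Q} {h : ι → QuditOp d}
  {V W : (q : Q) → Submodule ℂ (EuclideanSpace ℂ (Fin (d q)))}
  {T : ι → (q : Q) → Module.End ℂ (EuclideanSpace ℂ (Fin (d q)))} {c : ι → ℝ}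

theorem mono (hb : IsBrick S h V T c) (hWV : ∀ q, W q ≤ V q)
    (hW : ∀ i q, ∀ v ∈ W q, T i q v ∈ W q) : IsBrick S h W T c where
  symm := hb.symm
  maps := hW
  supp := hb.supp
  act i v hv := hb.act i v fun q => hWV q (hv q)
  comm i j := (hb.comm i j).imp (fun ⟨q, hq⟩ => ⟨q, fun v hv => hq v (hWV q hv)⟩)
    fun hq q => (hq q).imp (fun hq v hv => hq v (hWV q hv)) fun hq v hv => hq v (hWV q hv)

/-- Terms vanishing on a brick can be given the factors `1` and the coefficient `0`. -/
theorem exists_ne_zero (hb : IsBrick S h V T c) (hV : ∀ q, V q ≠ ⊥) :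
    ∃ T' c', IsBrick S h V T' c' ∧ ∀ i q, ∃ v ∈ V q, T' i q v ≠ 0 := by
  classical
  set P : ι → Prop := fun i => ∃ q, ∀ v ∈ V q, T i q v = 0
  refine ⟨fun i => if P i then fun _ => 1 else T i, fun i => if P i then 0 else c i,
    ⟨?_, ?_, ?_, ?_, ?_⟩, ?_⟩
  · intro i q
    by_cases hi : P i
    · simp only [if_pos hi]
      exact LinearMap.IsSymmetric.id
    · simpa only [if_neg hi] using hb.symm i q
  · intro i q v hv
    by_cases hi : P i
    · simp only [if_pos hi]
      exact hv
    · simpa only [if_neg hi] using hb.maps i q v hv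
  · intro i q hq
    by_cases hi : P i
    · simp only [if_pos hi]
    · simpa only [if_neg hi] using hb.supp i q hq
  · intro i v hv
    by_cases hi : P i
    · obtain ⟨q, hq⟩ := hi
      rw [hb.act i v hv, tensorVec_eq_zero (q := q) (hq _ (hv q))]
      simp only [if_pos (show P i from ⟨q, hq⟩), Complex.ofReal_zero, zero_smul, smul_zero]
    · simpa only [if_neg hi] using hb.act i v hv
  · intro i j
    by_cases hi : P i
    · exact Or.inr fun q => Or.inl fun v _ => by simp [if_pos hi]
    · by_cases hj : P j
      · exact Or.inr fun q => Or.inl fun v _ => by simp [if_pos hj]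
      · simpa only [if_neg hi, if_neg hj] using hb.comm i j
  · intro i q
    by_cases hi : P i
    · obtain ⟨v, hv, hv0⟩ := Submodule.exists_mem_ne_zero_of_ne_bot (hV q)
      exact ⟨v, hv, by simp only [if_pos hi]; exact hv0⟩
    · simp only [if_neg hi]
      by_contra! hq
      exact hi ⟨q, hq⟩

/-- The factors of the `i`-th term, as operators on the factors of the brick. -/
def factor (hb : IsBrick S h V T c) (i : ι) (q : Q) : Module.End ℂ (V q) :=
  (T i q).restrict (hb.maps i q)

theorem isSymmetric_factor (hb : IsBrick S h V T c) (i : ι) (q : Q) :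
    LinearMap.IsSymmetric (𝕜 := ℂ) (E := V q) (hb.factor i q) :=
  (hb.symm i q).restrict_invariant (hb.maps i q)

theorem factor_ne_zero (hb : IsBrick S h V T c) {i : ι} {q : Q} (hne : ∃ v ∈ V q, T i q v ≠ 0) :
    hb.factor i q ≠ 0 := fun h0 => by
  obtain ⟨v, hv, hv0⟩ := hne
  exact hv0 (congrArg Subtype.val (LinearMap.congr_fun h0 ⟨v, hv⟩))

theorem keepsInvariant (hb : IsBrick S h V T c) (i : ι) :
    KeepsInvariant (h i) (tensorSubspace V) := by
  suffices tensorSubspace V ≤ (tensorSubspace V).comap (Matrix.toEuclideanLin (h i)) from this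
  refine tensorSubspace_le fun v hv => ?_
  rw [Submodule.mem_comap, toEuclideanLin_eq_applyOp, hb.act i v hv]
  exact Submodule.smul_mem _ _ (tensorVec_mem_tensorSubspace fun q => hb.maps i q _ (hv q))

/-- On a brick with irreducible non-vanishing factors, all factors commute up to sign. The pairs
of factors annihilating each other form a relation as in `NoPropagation`: if `T i q` annihilates
`T j q`, irreducibility gives some `k` such that `T i q` does not commute up to sign with
`T k q`, so that the factors of `i` and `k` annihilate each other at another point. -/
theorem commuteUpToSign (hb : IsBrick S h V T c) (hS : NoPropagation S) (hV : ∀ q, V q ≠ ⊥)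
    (hne : ∀ i q, ∃ v ∈ V q, T i q v ≠ 0)
    (hirr : ∀ q, IsIrreducibleFamily (E := V q) fun i => hb.factor i q) (i j : ι) (q : Q) :
    CommuteUpToSign (hb.factor i q) (hb.factor j q) := by
  set r := hb.factor
  have hnt : ∀ q, Nontrivial (V q) := fun q => Submodule.nontrivial_iff_ne_bot.2 (hV q)
  have hsym : ∀ i q, LinearMap.IsSymmetric (𝕜 := ℂ) (E := V q) (r i q) := hb.isSymmetric_factor
  have hr0 : ∀ i q, r i q ≠ 0 := fun i q => hb.factor_ne_zero (hne i q)
  have hr1 : ∀ i, ∀ q ∉ S i, r i q = 1 := fun i q hq => LinearMap.ext fun v => Subtype.ext (by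
    change T i q v = v
    rw [hb.supp i q hq]
    rfl)
  have hcomm : ∀ i j, (∃ q, r i q * r j q = 0) ∨ ∀ q, CommuteUpToSign (r i q) (r j q) :=
    fun i j => (hb.comm i j).imp
      (fun ⟨q, hq⟩ => ⟨q, LinearMap.ext fun v => Subtype.ext (hq v v.2)⟩)
      fun hq q => commuteUpToSign_restrict (hb.maps i q) (hb.maps j q) (hq q)
  have hZcomm : ∀ i j q, r i q * r j q = 0 → CommuteUpToSign (r i q) (r j q) := fun i j q hz =>
    Or.inl (by rw [hz, (hsym i q).mul_eq_zero_comm (hsym j q) hz])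
  have hZ : ∀ i j q, ¬ r i q * r j q = 0 := by
    refine hS _ (fun i j q hz => (hsym i q).mul_eq_zero_comm (hsym j q) hz) (fun i j q hz => ?_)
      fun i j q hz => ?_
    · by_contra hq
      rw [hr1 i q hq, one_mul] at hz
      exact hr0 j q hz
    · have := hnt q
      obtain ⟨k, hk⟩ := (hirr q).exists_not_commuteUpToSign (fun i => hsym i q)
        (fun i => hr0 i q) hz
      obtain ⟨q', hq'⟩ := (hcomm i k).resolve_right fun hc => hk (hc q)
      refine ⟨k, q', ?_, ?_, ?_, ?_, hq'⟩
      · rintro rfl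
        exact hk (CommuteUpToSign.refl _)
      · rintro rfl
        exact hk (hZcomm _ _ _ hz)
      · rintro rfl
        exact hk (hZcomm _ _ _ hq')
      · by_contra hq
        refine hk ?_
        change CommuteUpToSign (r i q) (r k q)
        rw [hr1 k q hq]
        exact (CommuteUpToSign.one_left _).symm
  exact ((hcomm i j).resolve_left fun ⟨q, hq⟩ => hZ i j q hq) q

theorem isEquivQubitStabilizerOn (hb : IsBrick S h V T c) (hS : NoPropagation S)
    (hV : ∀ q, V q ≠ ⊥) (hne : ∀ i q, ∃ v ∈ V q, T i q v ≠ 0)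
    (hirr : ∀ q, IsIrreducibleFamily (E := V q) fun i => hb.factor i q) :
    IsEquivQubitStabilizerOn h V := by
  have hq : ∀ q, ∃ (m : ℕ) (U : QubitSpace m ≃ₗᵢ[ℂ] V q), ∀ i,
      ∃ (c : ℝ) (s : Fin m → PauliLabel), ∀ ψ,
        hb.factor i q (U ψ) = (c : ℂ) • U (applyOp (pauliString s) ψ) := by
    intro q
    have : Nontrivial (V q) := Submodule.nontrivial_iff_ne_bot.2 (hV q)
    exact exists_qubitSpace_equiv (fun i => hb.isSymmetric_factor i q)
      (fun i => hb.factor_ne_zero (hne i q)) (fun i j => hb.commuteUpToSign hS hV hne hirr i j q)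
      (hirr q)
  choose m U t s hts using hq
  refine ⟨m, U, fun i => ⟨c i * ∏ q, t q i, fun q => s q i, fun ψ => ?_⟩⟩
  rw [hb.act i _ fun q => (U q (ψ q)).2, Complex.ofReal_mul, mul_smul, Complex.ofReal_prod,
    ← tensorVec_smul]
  congr 2
  funext q
  exact congrArg Subtype.val (hts q i (ψ q))

end IsBrick

/-- The simple subspace `⨂_q V q` is an orthogonal sum of finitely many simple subspaces, each of
them preserved by all `h i` and unitarily identified with a space of qubits on which the `h i` act
as multiples of Pauli strings. -/
def HasStabilizerDecomposition (h : ι → QuditOp d)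
    (V : (q : Q) → Submodule ℂ (EuclideanSpace ℂ (Fin (d q)))) : Prop :=
  ∃ (κ : Type) (_ : Fintype κ) (W : κ → (q : Q) → Submodule ℂ (EuclideanSpace ℂ (Fin (d q)))),
    (Pairwise fun k l => tensorSubspace (W k) ⟂ tensorSubspace (W l)) ∧
    ⨆ k, tensorSubspace (W k) = tensorSubspace V ∧
    ∀ k, (∀ i, KeepsInvariant (h i) (tensorSubspace (W k))) ∧ IsEquivQubitStabilizerOn h (W k)

namespace HasStabilizerDecomposition

variable {h : ι → QuditOp d}
  {V V₁ V₂ : (q : Q) → Submodule ℂ (EuclideanSpace ℂ (Fin (d q)))}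

theorem of_eq_bot {q : Q} (hq : V q = ⊥) : HasStabilizerDecomposition h V :=
  ⟨Empty, inferInstance, fun k => k.elim, fun k => k.elim,
    by rw [tensorSubspace_eq_bot hq, iSup_of_empty], fun k => k.elim⟩

theorem sup (h₁ : HasStabilizerDecomposition h V₁) (h₂ : HasStabilizerDecomposition h V₂)
    (ho : tensorSubspace V₁ ⟂ tensorSubspace V₂)
    (hV : tensorSubspace V₁ ⊔ tensorSubspace V₂ = tensorSubspace V) :
    HasStabilizerDecomposition h V := by
  obtain ⟨κ₁, _, W₁, o₁, s₁, g₁⟩ := h₁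
  obtain ⟨κ₂, _, W₂, o₂, s₂, g₂⟩ := h₂
  have ho' : ∀ k l, tensorSubspace (W₁ k) ⟂ tensorSubspace (W₂ l) := fun k l =>
    ho.mono (s₁ ▸ le_iSup (fun k => tensorSubspace (W₁ k)) k)
      (s₂ ▸ le_iSup (fun k => tensorSubspace (W₂ k)) l)
  refine ⟨κ₁ ⊕ κ₂, inferInstance, Sum.elim W₁ W₂, ?_, ?_, ?_⟩
  · rintro (k | k) (l | l) hkl
    · exact o₁ fun e => hkl (by rw [e])
    · exact ho' k l
    · exact (ho' l k).symm
    · exact o₂ fun e => hkl (by rw [e])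
  · rw [iSup_sum]
    simpa [s₁, s₂] using hV
  · rintro (k | k)
    · exact g₁ k
    · exact g₂ k

theorem isEquivDirectSum [Fintype ι] (hd : HasStabilizerDecomposition h fun _ => ⊤) :
    IsEquivDirectSumQubitStabilizer h := by
  obtain ⟨κ, _, W, ho, hs, hg⟩ := hd
  set e := (Fintype.equivFin κ).symm
  have ho' : Pairwise fun k l => tensorSubspace (W (e k)) ⟂ tensorSubspace (W (e l)) :=
    fun k l hkl => ho (e.injective.ne hkl)
  refine ⟨Fintype.card κ, fun k => W (e k), ho', ?_, fun k => ⟨?_, (hg (e k)).1, (hg (e k)).2⟩⟩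
  · rw [(OrthogonalFamily.of_pairwise ho').isInternal_iff,
      e.iSup_comp (g := fun k => tensorSubspace (W k)), hs, tensorSubspace_top,
      Submodule.top_orthogonal_eq_bot]
  · intro ψ hψ
    rw [← toEuclideanLin_eq_applyOp, map_sum, LinearMap.sum_apply]
    exact Submodule.sum_mem _ fun i _ => (hg (e k)).1 i ψ hψ

end HasStabilizerDecomposition

theorem sum_finrank_update_lt
    (V : (q : Q) → Submodule ℂ (EuclideanSpace ℂ (Fin (d q)))) {q : Q}
    {W : Submodule ℂ (EuclideanSpace ℂ (Fin (d q)))} (hW : W < V q) :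
    ∑ r, Module.finrank ℂ (Function.update V q W r) < ∑ r, Module.finrank ℂ (V r) := by
  refine Finset.sum_lt_sum (fun r _ => ?_) ⟨q, Finset.mem_univ q, ?_⟩
  · by_cases hr : r = q
    · subst hr
      rw [Function.update_self]
      exact Submodule.finrank_mono hW.le
    · rw [Function.update_of_ne hr]
  · rw [Function.update_self]
    exact Submodule.finrank_lt_finrank_of_lt hW

/-- Every brick decomposes, by induction on the total dimension of its factors: as long as the
operators at some `q` have a proper invariant subspace, the brick splits into two smaller ones. -/
theorem IsBrick.hasStabilizerDecomposition {S : ι → Set Q} {h : ι → QuditOp d}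
    (hS : NoPropagation S) (n : ℕ) :
    ∀ (V : (q : Q) → Submodule ℂ (EuclideanSpace ℂ (Fin (d q))))
      (T : ι → (q : Q) → Module.End ℂ (EuclideanSpace ℂ (Fin (d q)))) (c : ι → ℝ),
      ∑ q, Module.finrank ℂ (V q) ≤ n → IsBrick S h V T c → HasStabilizerDecomposition h V := by
  induction n using Nat.strong_induction_on with
  | _ n ih =>
    intro V T c hn hb
    by_cases hV : ∃ q, V q = ⊥
    · obtain ⟨q, hq⟩ := hV
      exact .of_eq_bot hq
    push Not at hV
    obtain ⟨T, c, hb, hne⟩ := hb.exists_ne_zero hV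
    by_cases hirr : ∀ q, IsIrreducibleFamily (E := V q) fun i => hb.factor i q
    · exact ⟨Unit, inferInstance, fun _ => V, fun k l hkl => absurd rfl hkl, ciSup_const,
        fun _ => ⟨hb.keepsInvariant, hb.isEquivQubitStabilizerOn hS hV hne hirr⟩⟩
    · simp only [IsIrreducibleFamily, not_forall, not_or] at hirr
      obtain ⟨q, W₀, hinv₀, hbot₀, htop₀⟩ := hirr
      set W := W₀.map (V q).subtype with hW
      have hWV : W ≤ V q := Submodule.map_subtype_le _ _
      have hbot : W ≠ ⊥ := fun h0 => hbot₀
        (Submodule.map_injective_of_injective (V q).injective_subtype (by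
          rw [← hW, h0, Submodule.map_bot]))
      have htop : W ≠ V q := fun h0 => htop₀ (by
        refine Submodule.map_injective_of_injective (V q).injective_subtype ?_
        rw [← hW, h0, Submodule.map_subtype_top])
      have hinv : ∀ i, ∀ v ∈ W, T i q v ∈ W := by
        rintro i _ ⟨v, hv, rfl⟩
        exact ⟨_, hinv₀ i v hv, rfl⟩
      have hinv' : ∀ i, ∀ v ∈ Wᗮ ⊓ V q, T i q v ∈ Wᗮ ⊓ V q := fun i v hv =>
        ⟨fun w hw => by rw [← hb.symm i q]; exact hv.1 _ (hinv i w hw), hb.maps i q v hv.2⟩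
      have hne' : Wᗮ ⊓ V q ≠ V q := fun h0 => hbot <| by
        have : W ≤ Wᗮ := hWV.trans (inf_eq_right.1 h0)
        exact Submodule.isOrtho_self.1 (Submodule.isOrtho_iff_le.2 this)
      have key : ∀ W' : Submodule ℂ (EuclideanSpace ℂ (Fin (d q))), W' ≤ V q → W' ≠ V q →
          (∀ i, ∀ v ∈ W', T i q v ∈ W') →
          HasStabilizerDecomposition h (Function.update V q W') := by
        intro W' hle hne hmaps
        refine ih _ ((sum_finrank_update_lt V (lt_of_le_of_ne hle hne)).trans_le hn) _ T c le_rfl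
          (hb.mono (fun r => ?_) fun i r => ?_)
        · by_cases hr : r = q
          · subst hr
            simpa using hle
          · rw [Function.update_of_ne hr]
        · by_cases hr : r = q
          · subst hr
            simpa using hmaps i
          · rw [Function.update_of_ne hr]
            exact hb.maps i r
      refine (key W hWV htop hinv).sup (key (Wᗮ ⊓ V q) inf_le_right hne' hinv')
        (tensorSubspace_isOrtho (q := q) ?_) (tensorSubspace_update_sup V q ?_)
      · simp only [Function.update_self]
        exact (Submodule.isOrtho_orthogonal_right W).mono_right inf_le_left
      · exact Submodule.sup_orthogonal_inf_of_hasOrthogonalProjection hWV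

/-- Commuting factorized terms form a brick on the whole space. -/
theorem exists_isBrick_top {S : ι → Set Q} {h : ι → QuditOp d}
    (hfact : ∀ i, IsFactorizedOn (S i) (h i)) (hcomm : ∀ i j, h i * h j = h j * h i) :
    ∃ T c, IsBrick S h (fun _ => ⊤) T c := by
  choose A hherm hone hA using hfact
  have hherm' : ∀ i q, (A i q).IsHermitian := fun i q => by
    by_cases hq : q ∈ S i
    · exact hherm i q hq
    · rw [hone i q hq]
      exact Matrix.isHermitian_one
  have hmul : ∀ i j q v, Matrix.toEuclideanLin (A i q) (Matrix.toEuclideanLin (A j q) v) =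
      Matrix.toEuclideanLin (A i q * A j q) v := fun i j q v => by
    simp only [toEuclideanLin_eq_applyOp, applyOp, Matrix.mulVec_mulVec]
  refine ⟨fun i q => Matrix.toEuclideanLin (A i q), fun _ => 1, ?_, fun _ _ _ _ => trivial,
    fun i q hq => ?_, fun i v _ => ?_, fun i j => ?_⟩
  · exact fun i q => Matrix.isSymmetric_toEuclideanLin_iff.2 (hherm' i q)
  · refine LinearMap.ext fun v => ?_
    simp [hone i q hq]
  · rw [hA i, applyOp_tensorOp_tensorVec, Complex.ofReal_one, one_smul]
    rfl
  · have hc := hcomm i j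
    rw [hA i, hA j] at hc
    simp only [hmul]
    refine (exists_mul_eq_zero_or_commute_or_anticommute (hherm' i) (hherm' j) hc).imp
      (fun ⟨q, hq⟩ => ⟨q, fun v _ => by rw [hq]; simp⟩) fun hq q => (hq q).imp
        (fun hq v _ => by rw [hq]) fun hq v _ => by rw [hq]; simp

end Bricks

theorem mainTheorem2 (a b : ℕ) (d : LatticeVertex a b → ℕ)
    (h : LatticePlaquette a b → QuditOp d)
    (h_factorized : ∀ p, IsFactorizedOn (plaquetteVertices p) (h p))
    (h_commute : ∀ p p', h p * h p' = h p' * h p) :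
    IsEquivDirectSumQubitStabilizer h := by
  obtain ⟨T, c, hb⟩ := exists_isBrick_top h_factorized h_commute
  exact (hb.hasStabilizerDecomposition noPropagation_plaquetteVertices _ _ _ _
    le_rfl).isEquivDirectSum
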